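/- Let $\boldsymbol\eta=(\eta_t)_{t\in[0,1]}$ be a standard max-stable process (MSP) in $C[0,1]$. That is, $\boldsymbol\eta$ is a random element of $C[0,1]$ (with the sup-norm and its Borel $\sigma$-algebra) such that for every $n\ge 1$ there are $a_n,b_n\in C[0,1]$ with $a_n>0$ for which $\boldsymbol\eta$ has the same distribution as the pointwise maximum $\max_{1\le i\le n}(\boldsymbol\eta_i-b_n)/a_n$ of independent copies $\boldsymbol\eta_1,\dots,\boldsymbol\eta_n$ of $\boldsymbol\eta$, and $P(\eta_t\le x)=e^{x}$ for all $x\le 0$ and $t\in[0,1]$. Let $\boldsymbol Z=(Z_t)_{t\in[0,1]}$ be a generator of $\boldsymbol\eta$. That is, $\boldsymbol Z$ is a random element of $C[0,1]$, possibly on another probability space, with $\boldsymbol Z\ge 0$ a.s., $E(Z_t)=1$ for all $t\in[0,1]$, $m:=E(\sup_{t\in[0,1]}Z_t)<\infty$, and $$P\bigl(\eta_t\le f(t)\text{ for all }t\in[0,1]\bigr)=\exp\Bigl(-E\Bigl(\sup_{t\in[0,1]}|f(t)|\,Z_t\Bigr)\Bigr)$$ for every bounded function $f:[0,1]\to(-\infty,0]$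 with only finitely many discontinuities. Assume that $m>1$ and that $\widetilde m:=E(\inf_{t\in[0,1]}Z_t)>0$. Then the hitting probability $h(x):=P(\eta_t=x\text{ for some }t\in[0,1])$, $x\le 0$, satisfies $$h(0)=0,\qquad h(x)>0\ \text{ for all } x<0,\qquad \lim_{x\to-\infty}h(x)=0.$$ Moreover, $h$ is integrable on $(-\infty,0]$ and $$0<\int_{-\infty}^0 h(x)\,dx\le\frac{m-\widetilde m}{m\,\widetilde m}.$$ -/

import Mathlib

open MeasureTheory ProbabilityTheory Filter Topology Set unitInterval

/-- `C[0,1]` with the topology of the sup-norm carries its Borel σ-algebra. -/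
instance instMeasurableSpaceCI : MeasurableSpace C(I, ℝ) := borel C(I, ℝ)

instance instBorelSpaceCI : BorelSpace C(I, ℝ) := ⟨rfl⟩

/-- The normalized pointwise maximum `max_i (ξ_i - b) / a` of finitely many paths. -/
noncomputable def normalizedMax {n : ℕ} (a b : C(I, ℝ)) (ha : ∀ t, 0 < a t)
    (ξ : Fin (n + 1) → C(I, ℝ)) : C(I, ℝ) where
  toFun t := Finset.univ.sup' Finset.univ_nonempty fun i => (ξ i t - b t) / a t
  continuous_toFun := by
    refine Continuous.finset_sup'_apply Finset.univ_nonempty fun i _ => ?_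
    exact ((ξ i).continuous.sub b.continuous).div a.continuous fun t => (ha t).ne'

/-- A max-stable process in `C[0,1]`: for every `N = n + 1 ≥ 1` there are norming functions
`a > 0` and `b` in `C[0,1]` such that `η` has the same distribution on `C[0,1]` as
`max_{1 ≤ i ≤ N} (η_i - b) / a`, where `η_1, …, η_N` are independent copies of `η`
(realized as `η` composed with the coordinates of the product probability space). -/
structure IsMaxStableProcess {Ω : Type*} [MeasurableSpace Ω] (P : Measure Ω)
    (η : Ω → C(I, ℝ)) : Prop where
  measurable : Measurable η
  maxStable : ∀ n : ℕ, ∃ (a b : C(I, ℝ)) (ha : ∀ t, 0 < a t),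
    IdentDistrib η (fun ω : Fin (n + 1) → Ω => normalizedMax a b ha fun i => η (ω i))
      P (Measure.pi fun _ => P)

/-- A standard MSP: a max-stable process in `C[0,1]` with standard negative exponential
one-dimensional margins. -/
structure IsStandardMSP {Ω : Type*} [MeasurableSpace Ω] (P : Measure Ω)
    (η : Ω → C(I, ℝ)) : Prop extends IsMaxStableProcess P η where
  margin : ∀ (t : I) (x : ℝ), x ≤ 0 → P.real {ω | η ω t ≤ x} = Real.exp x

/-- The class `Ē⁻[0,1]` of bounded functions on `[0,1]` with only finitely many
discontinuities which do not attain positive values. -/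
structure IsEBarMinus (f : I → ℝ) : Prop where
  bounded : ∃ C : ℝ, ∀ t, |f t| ≤ C
  finite_discontinuities : {t | ¬ ContinuousAt f t}.Finite
  nonpos : ∀ t, f t ≤ 0

/-- `Z` is a generator (process) of `η`. The process `Z` may live on another probability
space. -/
structure IsGenerator {Ω Ω' : Type*} [MeasurableSpace Ω] [MeasurableSpace Ω']
    (P : Measure Ω) (η : Ω → C(I, ℝ)) (Q : Measure Ω') (Z : Ω' → C(I, ℝ)) : Prop where
  measurable : Measurable Z
  nonneg : ∀ᵐ ω ∂Q, ∀ t, 0 ≤ Z ω t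
  integrable : ∀ t, Integrable (fun ω => Z ω t) Q
  mean_one : ∀ t, ∫ ω, Z ω t ∂Q = 1
  integrable_sup : Integrable (fun ω => ⨆ t, Z ω t) Q
  distribution : ∀ f : I → ℝ, IsEBarMinus f →
    P.real {ω | ∀ t, η ω t ≤ f t} = Real.exp (-∫ ω, ⨆ t, |f t| * Z ω t ∂Q)

/-- The generator constant `m = E (sup_{t ∈ [0,1]} Z_t)`. -/
noncomputable def generatorConstant {Ω' : Type*} [MeasurableSpace Ω'] (Q : Measure Ω')
    (Z : Ω' → C(I, ℝ)) : ℝ :=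
  ∫ ω, ⨆ t, Z ω t ∂Q

/-- The constant `m̃ = E (inf_{t ∈ [0,1]} Z_t)`. -/
noncomputable def lowerGeneratorConstant {Ω' : Type*} [MeasurableSpace Ω'] (Q : Measure Ω')
    (Z : Ω' → C(I, ℝ)) : ℝ :=
  ∫ ω, ⨅ t, Z ω t ∂Q

/-- The hitting probability `h(x) = P(η_t = x for some t ∈ [0,1])`. -/
noncomputable def hittingProb {Ω : Type*} [MeasurableSpace Ω] (P : Measure Ω)
    (η : Ω → C(I, ℝ)) (x : ℝ) : ℝ :=
  P.real {ω | ∃ t, η ω t = x}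

/-! By the intermediate value theorem, `h x` is P(some `η_t ≤ x`) minus P(all `η_t < x`). For `x <
0` the latter is exp(`m x`) and the former lies between exp(`x`), from a single margin, and exp(`m'
x`); positivity, the limit and the integral 1/`m'` - 1/`m` follow.

The hard bound is exp(`m' x`). For finite `T`, inclusion–exclusion writes P(some `η_t ≤ x`, `t ∈ T`)
through the joint laws exp(`x` E max over `S`). Those laws are also the ones of `n` independent
copies all lying below `x/n`, so the probability is at most (1 - `F (1/n)`)^n, with limit
exp(-F'(0)). The max-min identity turns -F'(0) into `x` E min over `T`, at most `m' x`. Density of a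
sequence in `I` passes to all `t`. -/

/-- The alternating sum of maxima over the subsets of a finite set is a minimum. -/
theorem sum_powerset_neg_one_pow_card_mul_fold_max {ι : Type*} {T : Finset ι} (hT : T.Nonempty)
    (z : ι → ℝ) (c : ℝ) :
    ∑ S ∈ T.powerset, (-1 : ℝ) ^ S.card * S.fold max c z = c - max c (T.inf' hT z) := by
  classical
  induction hT using Finset.Nonempty.cons_induction generalizing c with
  | singleton a =>
    have hp : ({a} : Finset ι).powerset = {∅, {a}} := by
      ext S
      simp [Finset.subset_singleton_iff]
    rw [hp, Finset.sum_pair (Finset.singleton_ne_empty a).symm]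
    simp [max_comm, sub_eq_add_neg]
  | cons a s ha hs ih =>
    -- Adding `a` to `S` amounts to raising the base value to `max c (z a)`, hence the induction
    -- over arbitrary `c`.
    have key : ∀ S ∈ s.powerset, (-1 : ℝ) ^ (insert a S).card * (insert a S).fold max c z =
        -((-1 : ℝ) ^ S.card * S.fold max (max c (z a)) z) := by
      intro S hS
      have haS : a ∉ S := fun h => ha (Finset.mem_powerset.1 hS h)
      have hmax : (insert a S).fold max c z = S.fold max (max c (z a)) z := by
        refine eq_of_forall_ge_iff fun d => ?_
        simp only [Finset.fold_max_le, Finset.mem_insert, forall_eq_or_imp, max_le_iff, and_assoc]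
      rw [hmax, Finset.card_insert_of_notMem haS, pow_succ]
      ring
    have hsum : ∑ S ∈ (Finset.cons a s ha).powerset, (-1 : ℝ) ^ S.card * S.fold max c z =
        (c - max c (s.inf' hs z)) - (max c (z a) - max (max c (z a)) (s.inf' hs z)) := by
      rw [Finset.cons_eq_insert, Finset.sum_powerset_insert ha, Finset.sum_congr rfl key,
        Finset.sum_neg_distrib, ih, ih]
      ring
    rw [hsum, Finset.inf'_cons hs]
    set m := s.inf' hs z
    rcases le_total (z a) m with h1 | h1 <;> rcases le_total c (z a) with h2 | h2 <;>
      rcases le_total c m with h3 | h3 <;> simp [*] <;> linarith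

theorem Integrable.fold_max {α ι : Type*} [MeasurableSpace α] {μ : Measure α} {f : ι → α → ℝ}
    (hf : ∀ i, Integrable (f i) μ) (S : Finset ι) :
    Integrable (fun ω => S.fold max 0 fun i => f i ω) μ := by
  classical
  induction S using Finset.induction_on with
  | empty => simp
  | insert a s ha ih =>
    simp only [Finset.fold_insert ha]
    exact (hf a).sup ih

theorem tendsto_nat_mul_of_hasDerivAt_zero {F : ℝ → ℝ} {d : ℝ} (hF : HasDerivAt F d 0)
    (h0 : F 0 = 0) : Tendsto (fun n : ℕ => (n : ℝ) * F (n : ℝ)⁻¹) atTop (𝓝 d) := by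
  have h := hF.tendsto_slope_zero_right.comp
    (tendsto_inv_atTop_nhdsGT_zero.comp tendsto_natCast_atTop_atTop)
  simpa [Function.comp_def, h0] using h

theorem exists_lt_iff_denseSeq_lt {g : I → ℝ} (hg : Continuous g) (x : ℝ) :
    (∃ t, g t < x) ↔ ∃ n, g (TopologicalSpace.denseSeq I n) < x :=
  ⟨fun ⟨_, ht⟩ => (TopologicalSpace.denseRange_denseSeq I).exists_mem_open
    (isOpen_lt hg continuous_const) ⟨_, ht⟩, fun ⟨_, hn⟩ => ⟨_, hn⟩⟩

/-! ### Path events and finite-dimensional laws. -/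

section Paths

variable {Ω Ω' : Type*} [MeasurableSpace Ω] [MeasurableSpace Ω']
  {P : Measure Ω} {Q : Measure Ω'} {η : Ω → C(I, ℝ)} {Z : Ω' → C(I, ℝ)}

theorem measurable_eval_path (hη : Measurable η) (t : I) : Measurable fun ω => η ω t :=
  (ContinuousEvalConst.continuous_eval_const t).measurable.comp hη

theorem measurableSet_exists_lt (hη : Measurable η) (x : ℝ) :
    MeasurableSet {ω | ∃ t, η ω t < x} := by
  simp only [fun ω => exists_lt_iff_denseSeq_lt (η ω).continuous x, ofPred_exists]
  exact MeasurableSet.iUnion fun n => measurableSet_lt (measurable_eval_path hη _) measurable_const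

theorem measurableSet_forall_le (hη : Measurable η) (x : ℝ) :
    MeasurableSet {ω | ∀ t, η ω t ≤ x} := by
  have h : IsClosed {g : C(I, ℝ) | ∀ t, g t ≤ x} := by
    simp only [ofPred_forall]
    exact isClosed_iInter fun t => isClosed_le (ContinuousEvalConst.continuous_eval_const t)
      continuous_const
  exact hη h.measurableSet

theorem measurableSet_forall_lt (hη : Measurable η) (x : ℝ) :
    MeasurableSet {ω | ∀ t, η ω t < x} := by
  have h : IsOpen {g : C(I, ℝ) | ∀ t, g t < x} := by
    have := ContinuousMap.isOpen_setOfPred_mapsTo (X := I) (Y := ℝ) isCompact_univ (isOpen_Iio (a := x))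
    simpa [MapsTo] using this
  exact hη h.measurableSet

/-- By the intermediate value theorem a path hits `x` iff it neither stays above nor below `x`. -/
theorem hittingProb_eq_sub [IsFiniteMeasure P] (hη : Measurable η) (x : ℝ) :
    hittingProb P η x = P.real {ω | ∃ t, η ω t ≤ x} - P.real {ω | ∀ t, η ω t < x} := by
  have hset : {ω | ∃ t, η ω t = x} = {ω | ∃ t, η ω t ≤ x} \ {ω | ∀ t, η ω t < x} := by
    ext ω
    simp only [mem_ofPred_eq, Set.mem_sdiff, not_forall, not_lt]
    constructor
    · rintro ⟨t, rfl⟩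
      exact ⟨⟨t, le_rfl⟩, t, le_rfl⟩
    · rintro ⟨⟨s, hs⟩, t, ht⟩
      exact mem_range_of_exists_le_of_exists_ge (η ω).continuous ⟨s, hs⟩ ⟨t, ht⟩
  rw [hittingProb, hset, measureReal_sdiff _ (measurableSet_forall_lt hη x)]
  intro ω h
  exact ⟨0, (h 0).le⟩

theorem measurable_hittingProb [IsFiniteMeasure P] (hη : Measurable η) :
    Measurable (hittingProb P η) := by
  have h : hittingProb P η = fun x =>
      P.real {ω | ∃ t, η ω t ≤ x} - P.real {ω | ∀ t, η ω t < x} :=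
    funext (hittingProb_eq_sub hη)
  rw [h]
  refine Measurable.sub (Monotone.measurable fun x y hxy => ?_)
    (Monotone.measurable fun x y hxy => ?_)
  · exact measureReal_mono fun ω ⟨t, ht⟩ => ⟨t, ht.trans hxy⟩
  · exact measureReal_mono fun ω hω t => (hω t).trans_le hxy

theorem IsGenerator.measureReal_forall_le (hZ : IsGenerator P η Q Z) {x : ℝ} (hx : x ≤ 0) :
    P.real {ω | ∀ t, η ω t ≤ x} = Real.exp (generatorConstant Q Z * x) := by
  have h := hZ.distribution (fun _ => x)
    ⟨⟨|x|, fun _ => le_rfl⟩, by simp [continuousAt_const], fun _ => hx⟩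
  simp only [← Real.mul_iSup_of_nonneg (abs_nonneg x)] at h
  rw [h, integral_const_mul, abs_of_nonpos hx, generatorConstant, neg_mul, neg_neg, mul_comm]

/-- The test function is `x` on `S` and `0` elsewhere: its discontinuities lie in `S`, and off `S`
it imposes no constraint because `η ≤ 0` almost surely. -/
theorem IsGenerator.measureReal_forall_mem_le [IsProbabilityMeasure P]
    (hη : Measurable η) (hZ : IsGenerator P η Q Z) (S : Finset I) {x : ℝ} (hx : x ≤ 0) :
    P.real {ω | ∀ t ∈ S, η ω t ≤ x} =
      Real.exp (x * ∫ ω, S.fold max 0 (fun t => Z ω t) ∂Q) := by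
  classical
  have hcont : {t : I | ¬ ContinuousAt (fun t => if t ∈ S then x else (0 : ℝ)) t} ⊆ S := by
    intro t ht
    by_contra hS
    refine ht ((continuousAt_const (y := (0 : ℝ))).congr ?_)
    filter_upwards [S.finite_toSet.isClosed.isOpen_compl.mem_nhds hS] with s hs
    exact (if_neg hs).symm
  have h := hZ.distribution (fun t => if t ∈ S then x else 0)
    ⟨⟨|x|, fun t => by split_ifs <;> simp⟩, S.finite_toSet.subset hcont,
      fun t => by split_ifs <;> simp [hx]⟩
  have hneg : ∀ᵐ ω ∂P, ∀ t, η ω t ≤ 0 := by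
    have h0 := hZ.measureReal_forall_le (le_refl (0 : ℝ))
    rw [mul_zero, Real.exp_zero, measureReal_def, ENNReal.toReal_eq_one_iff] at h0
    exact (mem_ae_iff_prob_eq_one (measurableSet_forall_le hη 0)).2 h0
  have hint : ∫ ω, ⨆ t, |if t ∈ S then x else 0| * Z ω t ∂Q =
      ∫ ω, -x * S.fold max 0 (fun t => Z ω t) ∂Q := by
    refine integral_congr_ae ?_
    filter_upwards [hZ.nonneg] with ω hω
    have hb : ∀ t, |if t ∈ S then x else 0| * Z ω t ≤ -x * S.fold max 0 (fun t => Z ω t) := by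
      intro t
      split_ifs with ht
      · rw [abs_of_nonpos hx]
        exact mul_le_mul_of_nonneg_left ((Finset.le_fold_max _).2 (Or.inr ⟨t, ht, le_rfl⟩))
          (neg_nonneg.2 hx)
      · simp only [abs_zero, zero_mul]
        exact mul_nonneg (neg_nonneg.2 hx) ((Finset.le_fold_max _).2 (Or.inl le_rfl))
    refine le_antisymm (ciSup_le hb) ?_
    have hbdd : BddAbove (range fun t => |if t ∈ S then x else 0| * Z ω t) :=
      ⟨_, forall_mem_range.2 hb⟩
    rcases (Finset.le_fold_max _).1 (le_refl (S.fold max 0 (fun t => Z ω t))) with h | ⟨t, ht, h⟩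
    · calc -x * S.fold max 0 (fun t => Z ω t) ≤ 0 :=
            mul_nonpos_of_nonneg_of_nonpos (neg_nonneg.2 hx) h
        _ ≤ _ := Real.iSup_nonneg fun t => mul_nonneg (abs_nonneg _) (hω t)
    · refine le_trans ?_ (le_ciSup hbdd t)
      rw [if_pos ht, abs_of_nonpos hx]
      exact mul_le_mul_of_nonneg_left h (neg_nonneg.2 hx)
  rw [hint, integral_const_mul] at h
  rw [show x * ∫ ω, S.fold max 0 (fun t => Z ω t) ∂Q =
    -(-x * ∫ ω, S.fold max 0 (fun t => Z ω t) ∂Q) by ring, ← h]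
  refine measureReal_congr ?_
  filter_upwards [hneg] with ω hω
  refine propext ⟨fun h t => ?_, fun h t ht => ?_⟩
  · split_ifs with ht
    · exact h t ht
    · exact hω t
  · simpa [ht] using h t

theorem IsGenerator.lowerGeneratorConstant_le_sum (hZ : IsGenerator P η Q Z) {T : Finset I}
    (hT : T.Nonempty) (hm' : 0 < lowerGeneratorConstant Q Z) :
    lowerGeneratorConstant Q Z ≤ -∑ S ∈ T.powerset,
      (-1 : ℝ) ^ S.card * ∫ ω, S.fold max 0 (fun t => Z ω t) ∂Q := by
  have hint : ∀ S : Finset I, Integrable (fun ω => (-1 : ℝ) ^ S.card *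
      S.fold max 0 (fun t => Z ω t)) Q := fun S =>
    (Integrable.fold_max hZ.integrable S).const_mul _
  simp only [← integral_const_mul]
  rw [← integral_finsetSum _ fun S _ => hint S, ← integral_neg]
  -- A nonintegrable infimum would have Bochner integral `0`, so positivity of `m'` gives
  -- integrability.
  refine integral_mono_ae (Integrable.of_integral_ne_zero hm'.ne')
    (integrable_finsetSum _ fun S _ => hint S).neg ?_
  filter_upwards [hZ.nonneg] with ω hω
  simp only [sum_powerset_neg_one_pow_card_mul_fold_max hT, zero_sub, neg_neg]
  exact le_max_of_le_right (Finset.le_inf' hT _ fun t _ =>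
    ciInf_le ⟨0, forall_mem_range.2 hω⟩ t)

end Paths

/-! ### Exponential bounds on the tails and on the hitting probability. -/

section Bounds

variable {Ω Ω' : Type*} [MeasurableSpace Ω] [MeasurableSpace Ω']
  {P : Measure Ω} [IsProbabilityMeasure P] {Q : Measure Ω'} {η : Ω → C(I, ℝ)} {Z : Ω' → C(I, ℝ)}

theorem IsGenerator.measureReal_exists_mem_le (hη : Measurable η) (hZ : IsGenerator P η Q Z)
    (T : Finset I) {x : ℝ} (hx : x ≤ 0) :
    P.real (⋃ t ∈ T, {ω | η ω t ≤ x}) = ∑ S ∈ T.powerset with S.Nonempty,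
      (-1 : ℝ) ^ (S.card + 1) * Real.exp (x * ∫ ω, S.fold max 0 (fun t => Z ω t) ∂Q) := by
  rw [measureReal_biUnion_eq_sum_powerset fun t _ =>
    measurableSet_le (measurable_eval_path hη t) measurable_const]
  refine Finset.sum_congr rfl fun S _ => ?_
  rw [← hZ.measureReal_forall_mem_le hη S hx]
  congr 2
  ext ω
  simp

/-- The finite-dimensional max-stability of `η` bounds its lower tail by that of the maximum of
`n` independent copies. -/
theorem IsGenerator.measureReal_exists_mem_le_pow (hη : Measurable η) (hZ : IsGenerator P η Q Z)
    (T : Finset I) {x : ℝ} (hx : x ≤ 0) {n : ℕ} (hn : n ≠ 0) :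
    P.real (⋃ t ∈ T, {ω | η ω t ≤ x}) ≤ P.real (⋃ t ∈ T, {ω | η ω t ≤ x * (n : ℝ)⁻¹}) ^ n := by
  have hn' : (n : ℝ) ≠ 0 := Nat.cast_ne_zero.2 hn
  have hxn : x * (n : ℝ)⁻¹ ≤ 0 := mul_nonpos_of_nonpos_of_nonneg hx (by positivity)
  let B : I → Set (Fin n → Ω) := fun t => univ.pi fun _ => {ω | η ω t ≤ x * (n : ℝ)⁻¹}
  have hB : ∀ t ∈ T, MeasurableSet (B t) := fun t _ =>
    MeasurableSet.univ_pi fun _ => measurableSet_le (measurable_eval_path hη t) measurable_const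
  have hinter : ∀ S : Finset I, (Measure.pi fun _ : Fin n => P).real (⋂ t ∈ S, B t) =
      Real.exp (x * ∫ ω, S.fold max 0 (fun t => Z ω t) ∂Q) := by
    intro S
    have hS : ⋂ t ∈ S, B t = univ.pi fun _ => {ω | ∀ t ∈ S, η ω t ≤ x * (n : ℝ)⁻¹} := by
      ext ω
      simp only [B, mem_iInter, mem_univ_pi, mem_ofPred_eq]
      exact ⟨fun h i t ht => h t ht i, fun h t ht i => h i t ht⟩
    rw [hS, measureReal_def, Measure.pi_pi, Finset.prod_const, ENNReal.toReal_pow,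
      ← measureReal_def, hZ.measureReal_forall_mem_le hη S hxn, ← Real.exp_nat_mul,
      Finset.card_univ, Fintype.card_fin]
    congr 1
    field_simp
  -- Inclusion–exclusion determines a union from its intersections, and these agree on both sides by
  -- `hinter`.
  calc P.real (⋃ t ∈ T, {ω | η ω t ≤ x}) = (Measure.pi fun _ : Fin n => P).real (⋃ t ∈ T, B t) := by
        rw [hZ.measureReal_exists_mem_le hη T hx, measureReal_biUnion_eq_sum_powerset hB]
        simp only [hinter]
    _ ≤ (Measure.pi fun _ : Fin n => P).real
          (univ.pi fun _ => ⋃ t ∈ T, {ω | η ω t ≤ x * (n : ℝ)⁻¹}) := by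
        -- One `t` common to all copies is stronger than a separate `t` for each copy.
        refine measureReal_mono (iUnion₂_subset fun t ht ω hω i hi => ?_)
        exact mem_iUnion₂.2 ⟨t, ht, hω i hi⟩
    _ = _ := by
        rw [measureReal_def, Measure.pi_pi, Finset.prod_const, ENNReal.toReal_pow,
          ← measureReal_def, Finset.card_univ, Fintype.card_fin]

theorem IsGenerator.measureReal_exists_mem_le_exp (hη : Measurable η) (hZ : IsGenerator P η Q Z)
    (hm' : 0 < lowerGeneratorConstant Q Z) {T : Finset I} (hT : T.Nonempty)
    {x : ℝ} (hx : x ≤ 0) :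
    P.real (⋃ t ∈ T, {ω | η ω t ≤ x}) ≤ Real.exp (lowerGeneratorConstant Q Z * x) := by
  set M : Finset I → ℝ := fun S => ∫ ω, S.fold max 0 (fun t => Z ω t) ∂Q with hM
  have hM0 : M ∅ = 0 := by simp [hM]
  -- `F y` is the probability that no `t ∈ T` has `η_t ≤ x * y`, for `y ≥ 0`; see `hU`.
  set F : ℝ → ℝ := fun y => ∑ S ∈ T.powerset, (-1 : ℝ) ^ S.card * Real.exp (x * y * M S) with hF
  have hF0 : F 0 = 0 := by
    simp only [hF, mul_zero, zero_mul, Real.exp_zero, mul_one]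
    exact_mod_cast Finset.sum_powerset_neg_one_pow_card_of_nonempty hT
  have hF' : HasDerivAt F (∑ S ∈ T.powerset, (-1 : ℝ) ^ S.card * (x * M S)) 0 := by
    refine HasDerivAt.fun_sum fun S _ => ?_
    have h := (((hasDerivAt_id (0 : ℝ)).const_mul x).mul_const (M S)).exp.const_mul
      ((-1 : ℝ) ^ S.card)
    simpa using h
  have hU : ∀ y, 0 ≤ y → P.real (⋃ t ∈ T, {ω | η ω t ≤ x * y}) = 1 - F y := by
    intro y hy
    rw [hZ.measureReal_exists_mem_le hη T (mul_nonpos_of_nonpos_of_nonneg hx hy)]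
    simp only [hF]
    rw [← Finset.sum_filter_add_sum_filter_not T.powerset Finset.Nonempty]
    have hempty : T.powerset.filter (fun S => ¬ S.Nonempty) = {∅} := by
      ext S
      simp only [Finset.mem_filter, Finset.mem_powerset, Finset.not_nonempty_iff_eq_empty,
        Finset.mem_singleton]
      exact ⟨fun h => h.2, fun h => ⟨h ▸ Finset.empty_subset T, h⟩⟩
    rw [hempty, Finset.sum_singleton, hM0]
    simp [pow_succ, hM]
  have hlim : Tendsto (fun n : ℕ => Real.exp (-((n : ℝ) * F (n : ℝ)⁻¹))) atTop
      (𝓝 (Real.exp (-∑ S ∈ T.powerset, (-1 : ℝ) ^ S.card * (x * M S)))) :=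
    (Real.continuous_exp.tendsto _).comp (tendsto_nat_mul_of_hasDerivAt_zero hF' hF0).neg
  have hle : P.real (⋃ t ∈ T, {ω | η ω t ≤ x}) ≤
      Real.exp (-∑ S ∈ T.powerset, (-1 : ℝ) ^ S.card * (x * M S)) := by
    refine ge_of_tendsto hlim ?_
    filter_upwards [eventually_ne_atTop 0] with n hn
    have hUn := hU (n : ℝ)⁻¹ (by positivity)
    refine (hZ.measureReal_exists_mem_le_pow hη T hx hn).trans ?_
    -- Compare the bases of the `n`-th powers: `1 - F ≤ exp (-F)`.
    rw [← mul_neg, Real.exp_nat_mul]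
    refine pow_le_pow_left₀ measureReal_nonneg ?_ n
    rw [hUn]
    linarith [Real.add_one_le_exp (-F (n : ℝ)⁻¹)]
  refine hle.trans (Real.exp_le_exp.2 ?_)
  have hsum : -∑ S ∈ T.powerset, (-1 : ℝ) ^ S.card * (x * M S) =
      (-∑ S ∈ T.powerset, (-1 : ℝ) ^ S.card * M S) * x := by
    rw [neg_mul, Finset.sum_mul]
    exact congrArg _ (Finset.sum_congr rfl fun S _ => by ring)
  rw [hsum]
  exact mul_le_mul_of_nonpos_right (hZ.lowerGeneratorConstant_le_sum hT hm') hx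

theorem IsGenerator.measureReal_exists_lt_le (hη : Measurable η) (hZ : IsGenerator P η Q Z)
    (hm' : 0 < lowerGeneratorConstant Q Z) {x : ℝ} (hx : x ≤ 0) :
    P.real {ω | ∃ t, η ω t < x} ≤ Real.exp (lowerGeneratorConstant Q Z * x) := by
  classical
  let q := TopologicalSpace.denseSeq I
  let U : ℕ → Set Ω := fun n => ⋃ t ∈ (Finset.range (n + 1)).image q, {ω | η ω t ≤ x}
  have hsub : {ω | ∃ t, η ω t < x} ⊆ ⋃ n, U n := by
    intro ω hω
    obtain ⟨n, hn⟩ := (exists_lt_iff_denseSeq_lt (η ω).continuous x).1 hω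
    exact mem_iUnion.2 ⟨n, mem_iUnion₂.2 ⟨q n,
      Finset.mem_image_of_mem q (Finset.self_mem_range_succ n), hn.le⟩⟩
  have hmono : Monotone U := fun a b hab =>
    biUnion_subset_biUnion_left fun t ht =>
      Finset.image_subset_image (Finset.range_mono (Nat.succ_le_succ hab)) ht
  refine (measureReal_mono hsub).trans (le_of_tendsto
    ((ENNReal.tendsto_toReal (measure_ne_top P _)).comp (tendsto_measure_iUnion_atTop hmono))
    (Eventually.of_forall fun n => ?_))
  exact hZ.measureReal_exists_mem_le_exp hη hm'
    ((Finset.nonempty_range_add_one).image q) hx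

/-- The dense sequence only detects strict inequalities, so the bound is taken at `y` in `(x, 0)`
and `y` decreases to `x`. -/
theorem IsGenerator.measureReal_exists_le_le (hη : Measurable η) (hZ : IsGenerator P η Q Z)
    (hm' : 0 < lowerGeneratorConstant Q Z) {x : ℝ} (hx : x < 0) :
    P.real {ω | ∃ t, η ω t ≤ x} ≤ Real.exp (lowerGeneratorConstant Q Z * x) := by
  have hlim : Tendsto (fun y => Real.exp (lowerGeneratorConstant Q Z * y)) (𝓝[>] x)
      (𝓝 (Real.exp (lowerGeneratorConstant Q Z * x))) :=
    (Continuous.tendsto (by fun_prop) x).mono_left nhdsWithin_le_nhds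
  refine ge_of_tendsto hlim ?_
  filter_upwards [Ioo_mem_nhdsGT hx] with y hy
  have hsub : {ω | ∃ t, η ω t ≤ x} ⊆ {ω | ∃ t, η ω t < y} :=
    fun ω ⟨t, ht⟩ => ⟨t, ht.trans_lt hy.1⟩
  exact (measureReal_mono hsub).trans (hZ.measureReal_exists_lt_le hη hm' hy.2.le)

theorem IsGenerator.measureReal_forall_lt (hZ : IsGenerator P η Q Z) {x : ℝ} (hx : x ≤ 0) :
    P.real {ω | ∀ t, η ω t < x} = Real.exp (generatorConstant Q Z * x) := by
  refine le_antisymm ((measureReal_mono fun ω h t => (h t).le).trans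
    (hZ.measureReal_forall_le hx).le) ?_
  have hlim : Tendsto (fun y => Real.exp (generatorConstant Q Z * y)) (𝓝[<] x)
      (𝓝 (Real.exp (generatorConstant Q Z * x))) :=
    (Continuous.tendsto (by fun_prop) x).mono_left nhdsWithin_le_nhds
  refine le_of_tendsto hlim ?_
  filter_upwards [self_mem_nhdsWithin] with y hy
  rw [← hZ.measureReal_forall_le (le_of_lt (lt_of_lt_of_le hy hx))]
  exact measureReal_mono fun ω h t => (h t).trans_lt hy

theorem IsGenerator.hittingProb_le (hη : Measurable η) (hZ : IsGenerator P η Q Z)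
    (hm' : 0 < lowerGeneratorConstant Q Z) {x : ℝ} (hx : x < 0) :
    hittingProb P η x ≤ Real.exp (lowerGeneratorConstant Q Z * x) -
      Real.exp (generatorConstant Q Z * x) := by
  rw [hittingProb_eq_sub hη, hZ.measureReal_forall_lt hx.le]
  exact sub_le_sub_right (hZ.measureReal_exists_le_le hη hm' hx) _

theorem IsGenerator.hittingProb_zero (hη : Measurable η) (hZ : IsGenerator P η Q Z) :
    hittingProb P η 0 = 0 := by
  refine le_antisymm ?_ measureReal_nonneg
  rw [hittingProb_eq_sub hη, hZ.measureReal_forall_lt le_rfl, mul_zero, Real.exp_zero]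
  linarith [measureReal_le_one (μ := P) (s := {ω | ∃ t, η ω t ≤ 0})]

theorem IsGenerator.hittingProb_pos (hη : IsStandardMSP P η) (hZ : IsGenerator P η Q Z)
    (hm : 1 < generatorConstant Q Z) {x : ℝ} (hx : x < 0) : 0 < hittingProb P η x := by
  rw [hittingProb_eq_sub hη.measurable, hZ.measureReal_forall_lt hx.le, sub_pos]
  calc Real.exp (generatorConstant Q Z * x) < Real.exp x := Real.exp_lt_exp.2 (by nlinarith)
    _ = P.real {ω | η ω 0 ≤ x} := (hη.margin 0 x hx.le).symm
    _ ≤ P.real {ω | ∃ t, η ω t ≤ x} := measureReal_mono fun ω h => Exists.intro 0 h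

end Bounds

theorem mainTheorem3 {Ω Ω' : Type*} [MeasurableSpace Ω] [MeasurableSpace Ω']
    (P : Measure Ω) [IsProbabilityMeasure P] (Q : Measure Ω') [IsProbabilityMeasure Q]
    (η : Ω → C(I, ℝ)) (Z : Ω' → C(I, ℝ))
    (hη : IsStandardMSP P η) (hZ : IsGenerator P η Q Z)
    (hm : 1 < generatorConstant Q Z) (hm' : 0 < lowerGeneratorConstant Q Z) :
    hittingProb P η 0 = 0 ∧
    (∀ x : ℝ, x < 0 → 0 < hittingProb P η x) ∧
    Tendsto (hittingProb P η) atBot (𝓝 0) ∧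
    IntegrableOn (hittingProb P η) (Iic 0) ∧
    0 < ∫ x in Iic 0, hittingProb P η x ∧
    ∫ x in Iic 0, hittingProb P η x ≤
      (generatorConstant Q Z - lowerGeneratorConstant Q Z) /
        (generatorConstant Q Z * lowerGeneratorConstant Q Z) := by
  set m := generatorConstant Q Z
  set m' := lowerGeneratorConstant Q Z
  have hm0 : 0 < m := one_pos.trans hm
  have hpos : ∀ x : ℝ, x < 0 → 0 < hittingProb P η x := fun x hx => hZ.hittingProb_pos hη hm hx
  have hnonneg : ∀ x, 0 ≤ hittingProb P η x := fun x => measureReal_nonneg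
  have hle : ∀ x : ℝ, x ≤ 0 → hittingProb P η x ≤ Real.exp (m' * x) - Real.exp (m * x) := by
    intro x hx
    rcases hx.lt_or_eq with hx | rfl
    · exact hZ.hittingProb_le hη.measurable hm' hx
    -- At `0` both exponentials equal `1`, so the bound reads `h 0 ≤ 0`.
    · simp [hZ.hittingProb_zero hη.measurable]
  have hint : IntegrableOn (fun x => Real.exp (m' * x) - Real.exp (m * x)) (Iic 0) :=
    (integrableOn_exp_mul_Iic hm' 0).sub (integrableOn_exp_mul_Iic hm0 0)
  have hhint : IntegrableOn (hittingProb P η) (Iic 0) := by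
    refine hint.mono' (measurable_hittingProb hη.measurable).aestronglyMeasurable ?_
    filter_upwards [ae_restrict_mem measurableSet_Iic] with x hx
    rw [Real.norm_of_nonneg (hnonneg x)]
    exact hle x hx
  refine ⟨hZ.hittingProb_zero hη.measurable, hpos, ?_, hhint, ?_, ?_⟩
  · have hlim : Tendsto (fun x => Real.exp (m' * x)) atBot (𝓝 0) :=
      Real.tendsto_exp_atBot.comp (tendsto_id.const_mul_atBot hm')
    refine squeeze_zero' (Eventually.of_forall hnonneg) ?_ hlim
    filter_upwards [eventually_le_atBot 0] with x hx
    exact (hle x hx).trans (sub_le_self _ (Real.exp_pos _).le)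
  · rw [setIntegral_pos_iff_support_of_nonneg_ae (Eventually.of_forall hnonneg) hhint]
    refine lt_of_lt_of_le ?_ (measure_mono (μ := volume) (s := Iio (0 : ℝ)) fun x hx =>
      ⟨(hpos x hx).ne', mem_Iic.2 (le_of_lt hx)⟩)
    simp
  · calc ∫ x in Iic 0, hittingProb P η x
        ≤ ∫ x in Iic 0, (Real.exp (m' * x) - Real.exp (m * x)) :=
          setIntegral_mono_on hhint hint measurableSet_Iic hle
      _ = (m - m') / (m * m') := by
          rw [integral_sub (integrableOn_exp_mul_Iic hm' 0) (integrableOn_exp_mul_Iic hm0 0),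
            integral_exp_mul_Iic hm', integral_exp_mul_Iic hm0]
          simp only [mul_zero, Real.exp_zero]
          field_simp
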